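/- Let $N\ge 2$ be an even integer. Consider the problem of maximizing $\sum_{j=1}^N \alpha_j$ over all real polynomials $F(z)=\sum_{j=1}^N\alpha_j z^j$ with $\alpha_1=1$ and $\sum_{j=1}^N\alpha_j\sin jt\ge 0$ for all $t\in[0,\pi]$. Then this problem has exactly one extremal polynomial (a feasible polynomial at which the maximum is attained), and all of its coefficients $\alpha_1,\dots,\alpha_N$ are positive. -/

import Mathlib

/-- The sine polynomial `∑_{j=1}^N α_j sin (j t)` attached to the real polynomial
`F(z) = ∑_{j=1}^N α_j z^j`. -/
noncomputable def sinePoly (N : ℕ) (F : Polynomial ℝ) (t : ℝ) : ℝ :=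
  ∑ j ∈ Finset.Icc 1 N, F.coeff j * Real.sin ((j : ℝ) * t)

/-- The objective `∑_{j=1}^N α_j` of the auxiliary problem. -/
noncomputable def coeffSum (N : ℕ) (F : Polynomial ℝ) : ℝ :=
  ∑ j ∈ Finset.Icc 1 N, F.coeff j

/-- The feasible set of the auxiliary problem: the real polynomials
`F(z) = z + ∑_{j=2}^N α_j z^j` whose sine polynomial is nonnegative on `[0, π]`. -/
def feasibleSet (N : ℕ) : Set (Polynomial ℝ) :=
  {F | F.natDegree ≤ N ∧ F.coeff 0 = 0 ∧ F.coeff 1 = 1 ∧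
    ∀ t ∈ Set.Icc (0 : ℝ) Real.pi, 0 ≤ sinePoly N F t}

/-- `F` is an extremal polynomial of the auxiliary problem: it is feasible and maximizes
the sum of the coefficients among all feasible polynomials. -/
def IsExtremal (N : ℕ) (F : Polynomial ℝ) : Prop :=
  F ∈ feasibleSet N ∧ IsMaxOn (coeffSum N) (feasibleSet N) F

/-! Dividing by `sin t` turns a nonnegative sine polynomial into `p (cos t)` with `p ≥ 0` on `[-1,
1]`. By a Fejér-type argument this is a finite sum of `|g (e^{it})|²` with `deg g < N`. With `d_k =
∑ g_i g_{i+k}`, each `g` contributes `d_{j-1} - d_{j+1}` to `α_j`, so it adds `d₀ - d₂` to `α₁` and,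
by telescoping, `d₀ + d₁` to the objective. The problem is thus to maximize a Rayleigh quotient.

Suppose a positive `H` on `[0, N)` is annihilated by the band matrix of `lam (d₀ - d₂) - (d₀ + d₁)`.
Writing `g = H x` makes this form a weighted sum of squares of the differences `x_i - x_{i+1}` and
`x_i - x_{i+2}` (`IsGroundState.quadratic_form_eq`). Hence the maximum is `lam`, and equality forces
`x` to be constant, which gives uniqueness. For even `N` such an `H` is explicit
(`exists_isGroundState`). It is symmetric and decreasing away from its centre, so all differences
`d_{j-1} - d_{j+1}` are positive (`autocorr_sub_pos`). -/

/-! ### Nonnegative polynomials on `[-1, 1]` as sums of squared moduli -/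

open Polynomial in
/-- `p (cos t)` is a finite sum of terms `|g (e^{it})|²` with real polynomials `g` of degree at
most `n`. -/
def IsSumNormSq (n : ℕ) (p : ℝ[X]) : Prop :=
  ∃ l : List ℝ[X], (∀ g ∈ l, g.natDegree ≤ n) ∧ ∀ t : ℝ, p.eval (Real.cos t) =
    (l.map fun g => Complex.normSq (aeval (Complex.exp (t * Complex.I)) g)).sum

namespace IsSumNormSq

open Polynomial

theorem add_const {n : ℕ} {p : ℝ[X]} (hp : IsSumNormSq n p) {μ : ℝ} (hμ : 0 ≤ μ) :
    IsSumNormSq n (p + C μ) := by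
  obtain ⟨l, hl, h⟩ := hp
  refine ⟨C (Real.sqrt μ) :: l, ?_, fun t => ?_⟩
  · simpa using hl
  · simp [h t, Complex.normSq_ofReal, Real.mul_self_sqrt hμ, add_comm]

theorem mul {n m : ℕ} {p q : ℝ[X]} (hp : IsSumNormSq n p) (g : ℝ[X]) (hg : g.natDegree ≤ m)
    (hq : ∀ t : ℝ, q.eval (Real.cos t) =
      Complex.normSq (aeval (Complex.exp (t * Complex.I)) g)) :
    IsSumNormSq (m + n) (q * p) := by
  obtain ⟨l, hl, h⟩ := hp
  refine ⟨l.map (g * ·), ?_, fun t => ?_⟩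
  · intro f hf
    obtain ⟨f', hf', rfl⟩ := List.mem_map.1 hf
    exact natDegree_mul_le.trans (add_le_add hg (hl _ hf'))
  · rw [eval_mul, hq, h, ← List.sum_map_mul_left, List.map_map]
    congr 2
    funext f
    simp

theorem mono {n m : ℕ} {p : ℝ[X]} (hp : IsSumNormSq n p) (h : n ≤ m) : IsSumNormSq m p := by
  obtain ⟨l, hl, h'⟩ := hp
  exact ⟨l, fun g hg => (hl g hg).trans h, h'⟩

theorem zero (n : ℕ) : IsSumNormSq n 0 := ⟨[], by simp, by simp⟩

end IsSumNormSq

/-- Supplies the squared-modulus forms of the two factors split off below: `(x - x₀)²` at an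
interior root and `1 - x₀ x` at an endpoint `x₀ = ±1`. -/
theorem normSq_exp_combination (a b c t : ℝ) :
    Complex.normSq (a * Complex.exp (t * Complex.I) ^ 2 + b * Complex.exp (t * Complex.I) + c) =
      a ^ 2 + b ^ 2 + c ^ 2 + 2 * b * (a + c) * Real.cos t +
        2 * a * c * (2 * Real.cos t ^ 2 - 1) := by
  rw [Complex.exp_mul_I, ← Complex.ofReal_cos, ← Complex.ofReal_sin, Complex.normSq_apply]
  simp only [pow_two, Complex.add_re, Complex.mul_re, Complex.add_im, Complex.mul_im,
    Complex.ofReal_re, Complex.ofReal_im, Complex.I_re, Complex.I_im]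
  have h := Real.sin_sq_add_cos_sq t
  set x := Real.cos t
  set y := Real.sin t
  have hy : y ^ 2 = 1 - x ^ 2 := by linarith
  ring_nf
  simp only [show y ^ 4 = (y ^ 2) ^ 2 by ring, hy]
  ring

-- Division on a dense subset of the interval, then continuity. The excluded point allows `q` to
-- vanish at an interior `x₀`.
open Polynomial in
theorem eval_nonneg_of_mul_nonneg {p q : ℝ[X]} {x₀ : ℝ}
    (h : ∀ x ∈ Set.Ioo (-1 : ℝ) 1, x ≠ x₀ → 0 < q.eval x)
    (hpq : ∀ x ∈ Set.Icc (-1 : ℝ) 1, 0 ≤ (q * p).eval x) :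
    ∀ x ∈ Set.Icc (-1 : ℝ) 1, 0 ≤ p.eval x := by
  have key : Set.Icc (-1 : ℝ) 1 ⊆ closure (Set.Ioo (-1 : ℝ) 1 ∩ {x₀}ᶜ) := by
    rw [← closure_Ioo (by norm_num : (-1 : ℝ) ≠ 1)]
    refine closure_minimal ?_ isClosed_closure
    have : Dense ({x₀}ᶜ : Set ℝ) := dense_compl_singleton x₀
    exact this.open_subset_closure_inter isOpen_Ioo
  have hcl : IsClosed {x : ℝ | 0 ≤ p.eval x} := isClosed_le continuous_const p.continuous
  intro x hx
  refine closure_minimal (fun y hy => ?_) hcl (key hx)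
  have hy1 := Set.Ioo_subset_Icc_self hy.1
  have := hpq y hy1
  rw [eval_mul] at this
  exact nonneg_of_mul_nonneg_right this (h y hy.1 hy.2)

open Polynomial in
/-- A real polynomial of degree at most `n` nonnegative on `[-1, 1]` becomes, after substituting
`cos t`, a finite sum of squared moduli of polynomials in `e^{it}` of degree at most `n`. -/
theorem isSumNormSq_of_nonneg (n : ℕ) (p : ℝ[X]) (hn : p.natDegree ≤ n)
    (hp : ∀ x ∈ Set.Icc (-1 : ℝ) 1, 0 ≤ p.eval x) : IsSumNormSq n p := by
  induction n using Nat.strong_induction_on generalizing p with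
  | _ n ih =>
  obtain ⟨x₀, hx₀, hmin⟩ := isCompact_Icc.exists_isMinOn
    (Set.nonempty_Icc.2 (by norm_num : (-1 : ℝ) ≤ 1)) p.continuous.continuousOn
  -- The minimum value is itself a nonnegative constant, hence a square; subtracting it creates a
  -- root in `[-1, 1]` to divide out.
  set f : ℝ[X] := p - C (p.eval x₀) with hf
  suffices IsSumNormSq n f by
    have h := this.add_const (hp x₀ hx₀)
    rwa [hf, sub_add_cancel] at h
  have hfn : f.natDegree ≤ n := by rw [hf, natDegree_sub_C]; exact hn
  have hfx : f.eval x₀ = 0 := by simp [hf]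
  have hfp : ∀ x ∈ Set.Icc (-1 : ℝ) 1, 0 ≤ f.eval x := fun x hx => by
    have := isMinOn_iff.1 hmin x hx
    simpa [hf] using this
  by_cases hf0 : f = 0
  · rw [hf0]; exact IsSumNormSq.zero n
  by_cases hint : x₀ ∈ Set.Ioo (-1 : ℝ) 1
  · have hder : f.derivative.eval x₀ = 0 := by
      have hloc : IsLocalMin (fun x => f.eval x) x₀ := by
        filter_upwards [Ioo_mem_nhds hint.1 hint.2] with x hx
        rw [hfx]
        exact hfp x (Set.Ioo_subset_Icc_self hx)
      exact hloc.hasDerivAt_eq_zero (f.hasDerivAt x₀)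
    obtain ⟨q, hq⟩ : (X - C x₀) ^ 2 ∣ f := by
      have := (one_lt_rootMultiplicity_iff_isRoot hf0).2 ⟨hfx, hder⟩
      exact (pow_dvd_pow _ this).trans (pow_rootMultiplicity_dvd f x₀)
    have hq0 : q ≠ 0 := by rintro rfl; simp at hq; exact hf0 hq
    have hdeg : f.natDegree = 2 + q.natDegree := by
      rw [hq, natDegree_mul (pow_ne_zero _ (X_sub_C_ne_zero _)) hq0, natDegree_pow,
        natDegree_X_sub_C]
    have hqp : ∀ x ∈ Set.Icc (-1 : ℝ) 1, 0 ≤ q.eval x := by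
      refine eval_nonneg_of_mul_nonneg (q := (X - C x₀) ^ 2) (x₀ := x₀) (fun x _ hx => ?_) ?_
      · have := sub_ne_zero.2 hx
        simp only [eval_pow, eval_sub, eval_X, eval_C]
        positivity
      · rw [← hq]; exact hfp
    -- For `z = e^{it}`, `(z² - 2 x₀ z + 1) / 2 = z (cos t - x₀)`. The double root costs two degrees
    -- and the square restores exactly two.
    have h := (ih (n - 2) (by omega) q (by omega) hqp).mul (m := 2) (q := (X - C x₀) ^ 2)
      (C (1 / 2) * X ^ 2 + C (-x₀) * X + C (1 / 2)) (by compute_degree) (fun t => ?_)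
    · rw [← hq] at h
      exact h.mono (by omega)
    · have := normSq_exp_combination (1 / 2) (-x₀) (1 / 2) t
      simp only [map_add, map_mul, map_pow, aeval_X, aeval_C, Complex.coe_algebraMap]
      rw [this]
      simp only [eval_pow, eval_sub, eval_X, eval_C]
      ring
  · obtain ⟨q, hq⟩ : X - C x₀ ∣ f := dvd_iff_isRoot.2 hfx
    have hq0 : q ≠ 0 := by rintro rfl; simp at hq; exact hf0 hq
    have hdeg : f.natDegree = 1 + q.natDegree := by
      rw [hq, natDegree_mul (X_sub_C_ne_zero _) hq0, natDegree_X_sub_C]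
    have hends : x₀ = 1 ∨ x₀ = -1 := by
      rcases hx₀ with ⟨h1, h2⟩
      simp only [Set.mem_Ioo, not_and, not_lt] at hint
      rcases h1.eq_or_lt with h | h
      · exact Or.inr h.symm
      · exact Or.inl (le_antisymm h2 (hint h))
    have hsq : x₀ ^ 2 = 1 := by rcases hends with h | h <;> rw [h] <;> norm_num
    -- At an endpoint the root may be simple; the factor is normalized to be nonnegative on `[-1,
    -- 1]`, and it equals `|z - x₀|² / 2`.
    have hfac : f = (1 - C x₀ * X) * (C (-x₀) * q) := by
      have : (C x₀ : ℝ[X]) ^ 2 = 1 := by rw [← C_pow, hsq, C_1]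
      rw [hq, C_neg]
      linear_combination (-X * q) * this
    have hqp : ∀ x ∈ Set.Icc (-1 : ℝ) 1, 0 ≤ (C (-x₀) * q).eval x := by
      refine eval_nonneg_of_mul_nonneg (q := 1 - C x₀ * X) (x₀ := x₀) (fun x hx _ => ?_) ?_
      · simp only [eval_sub, eval_one, eval_mul, eval_C, eval_X]
        rcases hends with h | h <;> rw [h]
        · linarith [hx.2]
        · linarith [hx.1]
      · rw [← hfac]; exact hfp
    have h := (ih (n - 1) (by omega) _ ((natDegree_C_mul_le _ _).trans (by omega)) hqp).mul
      (m := 1) (q := 1 - C x₀ * X) (C (Real.sqrt 2 / 2) * X + C (-x₀ * (Real.sqrt 2 / 2)))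
      (by compute_degree) (fun t => ?_)
    · rw [← hfac] at h
      exact h.mono (by omega)
    · have := normSq_exp_combination 0 (Real.sqrt 2 / 2) (-x₀ * (Real.sqrt 2 / 2)) t
      simp only [map_add, map_mul, aeval_X, aeval_C, Complex.coe_algebraMap]
      simp only [Complex.ofReal_zero, zero_mul, zero_add, Complex.ofReal_mul,
        Complex.ofReal_neg] at this
      simp only [Complex.ofReal_neg]
      rw [this]
      have h2 : Real.sqrt 2 ^ 2 = 2 := Real.sq_sqrt (by norm_num)
      simp only [eval_sub, eval_one, eval_mul, eval_C, eval_X]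
      linear_combination (-(1 / 2) * x₀ ^ 2 / 2 - 1 / 4 + 1/2 * x₀ * Real.cos t) * h2 -
        (1 / 2) * hsq

/-! ### Sine polynomials and Chebyshev polynomials of the second kind -/

open Polynomial in
/-- `∑ α_j U_{j-1}`, the polynomial with `sin t * p (cos t) = ∑ α_j sin (j t)`. -/
noncomputable def sineQuotient (N : ℕ) (a : ℕ → ℝ) : ℝ[X] :=
  ∑ i ∈ Finset.range N, C (a (i + 1)) * Chebyshev.U ℝ i

theorem sum_Icc_one_eq_range (N : ℕ) (f : ℕ → ℝ) :
    ∑ j ∈ Finset.Icc 1 N, f j = ∑ i ∈ Finset.range N, f (i + 1) := by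
  rw [Finset.range_eq_Ico, Finset.sum_Ico_add' f 0 N 1]
  rfl

theorem sineQuotient_eval_cos (N : ℕ) (a : ℕ → ℝ) (t : ℝ) :
    (sineQuotient N a).eval (Real.cos t) * Real.sin t =
      ∑ j ∈ Finset.Icc 1 N, a j * Real.sin ((j : ℝ) * t) := by
  rw [sum_Icc_one_eq_range, sineQuotient, Polynomial.eval_finsetSum, Finset.sum_mul]
  refine Finset.sum_congr rfl fun i _ => ?_
  have := Polynomial.Chebyshev.U_real_cos t i
  rw [Polynomial.eval_mul, Polynomial.eval_C, mul_assoc, this]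
  push_cast
  rfl

theorem natDegree_sineQuotient_le (N : ℕ) (a : ℕ → ℝ) :
    (sineQuotient N a).natDegree ≤ N - 1 := by
  refine Polynomial.natDegree_sum_le_of_forall_le _ _ fun i hi => ?_
  refine (Polynomial.natDegree_C_mul_le _ _).trans ?_
  rw [Polynomial.Chebyshev.natDegree_U_natCast]
  have := Finset.mem_range.1 hi
  omega

/-- The sine functions `sin (j t)`, `j ≥ 1`, are linearly independent. -/
theorem coeff_eq_of_sine_sum_eq {N : ℕ} {a b : ℕ → ℝ}
    (h : ∀ t : ℝ, ∑ j ∈ Finset.Icc 1 N, a j * Real.sin ((j : ℝ) * t) =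
      ∑ j ∈ Finset.Icc 1 N, b j * Real.sin ((j : ℝ) * t)) :
    ∀ j ∈ Finset.Icc 1 N, a j = b j := by
  have hpoly : sineQuotient N a = sineQuotient N b := by
    refine Polynomial.eq_of_infinite_eval_eq _ _
      ((Set.Ioo_infinite (by norm_num : (-1 : ℝ) < 1)).mono fun x hx => ?_)
    have hs : Real.sin (Real.arccos x) ≠ 0 := by
      rw [Real.sin_arccos]
      have : 0 < 1 - x ^ 2 := by nlinarith [hx.1, hx.2]
      positivity
    have := h (Real.arccos x)
    rw [← sineQuotient_eval_cos, ← sineQuotient_eval_cos] at this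
    have := mul_right_cancel₀ hs this
    rwa [Real.cos_arccos hx.1.le hx.2.le] at this
  let S : Polynomial.Sequence ℝ :=
    ⟨fun i => Polynomial.Chebyshev.U ℝ i, fun i => Polynomial.Chebyshev.degree_U_natCast ℝ i⟩
  have hS := linearIndependent_iff'.1 S.linearIndependent (Finset.range N)
    (fun i => a (i + 1) - b (i + 1)) (by
      have := sub_eq_zero.2 hpoly
      rw [sineQuotient, sineQuotient, ← Finset.sum_sub_distrib] at this
      rw [← this]
      refine Finset.sum_congr rfl fun i _ => ?_
      rw [Polynomial.smul_eq_C_mul, Polynomial.C_sub, sub_mul])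
  intro j hj
  obtain ⟨h1, h2⟩ := Finset.mem_Icc.1 hj
  have := hS (j - 1) (Finset.mem_range.2 (by omega))
  rw [Nat.sub_add_cancel h1] at this
  exact sub_eq_zero.1 this

/-! ### Autocorrelations and the sine coefficients of a squared modulus -/

/-- The sequence `g` vanishes outside `[0, N)`. -/
def SupportedBelow (N : ℕ) (g : ℤ → ℝ) : Prop := ∀ i, i ∉ Set.Ico (0 : ℤ) N → g i = 0

/-- The autocorrelation `∑ g_i g_{i+k}` of a finitely supported sequence. -/
noncomputable def autocorr (g : ℤ → ℝ) (k : ℤ) : ℝ := ∑' i, g i * g (i + k)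

theorem SupportedBelow.eq_zero_mul {N : ℕ} {g : ℤ → ℝ} (hg : SupportedBelow N g) (φ : ℤ → ℝ) :
    ∀ i ∉ Finset.Ico (0 : ℤ) N, g i * φ i = 0 := fun i hi => by
  rw [hg i (by simpa using hi), zero_mul]

theorem SupportedBelow.summable_mul {N : ℕ} {g : ℤ → ℝ} (hg : SupportedBelow N g)
    (φ : ℤ → ℝ) : Summable fun i => g i * φ i :=
  summable_of_ne_finset_zero (hg.eq_zero_mul φ)

theorem SupportedBelow.tsum_mul {N : ℕ} {g : ℤ → ℝ} (hg : SupportedBelow N g)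
    (φ : ℤ → ℝ) : ∑' i, g i * φ i = ∑ i ∈ Finset.range N, g i * φ i := by
  rw [tsum_eq_sum (hg.eq_zero_mul φ)]
  symm
  refine Finset.sum_of_injOn (fun n : ℕ => (n : ℤ)) (fun _ _ _ _ h => by simpa using h)
    (fun i hi => by simpa using hi) (fun i hi hn => ?_) (fun _ _ => rfl)
  exact absurd ⟨i.toNat, by simp at hi ⊢; omega, by simp at hi ⊢; omega⟩ hn

theorem tsum_add_right (f : ℤ → ℝ) (k : ℤ) : ∑' i, f (i + k) = ∑' i, f i :=
  (Equiv.addRight k).tsum_eq f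

theorem autocorr_neg (g : ℤ → ℝ) (k : ℤ) : autocorr g (-k) = autocorr g k := by
  rw [autocorr, ← tsum_add_right _ k, autocorr]
  refine tsum_congr fun i => ?_
  rw [add_neg_cancel_right, mul_comm]

theorem autocorr_eq_zero {N : ℕ} {g : ℤ → ℝ} (hg : SupportedBelow N g) {k : ℤ} (hk : N ≤ k) :
    autocorr g k = 0 := by
  rw [autocorr, hg.tsum_mul fun i => g (i + k)]
  refine Finset.sum_eq_zero fun i hi => ?_
  rw [hg (i + k) (by simp; omega), mul_zero]

theorem sum_Icc_neg_eq (N : ℕ) (f : ℤ → ℝ) :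
    ∑ n ∈ Finset.Icc (-(N : ℤ)) N, f n = f 0 + ∑ j ∈ Finset.Icc 1 N, (f j + f (-j)) := by
  induction N with
  | zero => simp
  | succ N ih =>
    have h : Finset.Icc (-((N + 1 : ℕ) : ℤ)) ((N + 1 : ℕ) : ℤ) =
        insert (((N + 1 : ℕ) : ℤ)) (insert (-((N + 1 : ℕ) : ℤ)) (Finset.Icc (-(N : ℤ)) N)) := by
      ext x
      simp only [Finset.mem_Icc, Finset.mem_insert]
      omega
    rw [h, Finset.sum_insert, Finset.sum_insert, ih, Finset.sum_Icc_succ_top (by omega)]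
    · ring
    · simp
    · simp only [Finset.mem_insert, Finset.mem_Icc]
      omega

theorem sum_range_eq_sum_Icc {N : ℕ} {g : ℤ → ℝ} (hg : SupportedBelow N g) {b : ℕ}
    (hb : b < N) (φ : ℤ → ℝ) :
    ∑ a ∈ Finset.range N, g a * φ (a - b + 1) =
      ∑ n ∈ Finset.Icc (-(N : ℤ)) N, g (b + (n - 1)) * φ n := by
  refine Finset.sum_of_injOn (fun a : ℕ => ((a : ℤ) - b + 1)) (fun _ _ _ _ h => ?_)
    (fun i hi => ?_) (fun i hi hn => ?_) (fun i _ => ?_)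
  · simpa using h
  · simp at hi ⊢
    omega
  · rw [hg, zero_mul]
    intro hmem
    refine hn ⟨(b + (i - 1)).toNat, ?_, ?_⟩ <;> simp at hmem ⊢ <;> omega
  · congr 2
    ring

/-- The squared modulus `|∑ g_a e^{iat}|²`. -/
noncomputable def trigNormSq (N : ℕ) (g : ℤ → ℝ) (t : ℝ) : ℝ :=
  (∑ a ∈ Finset.range N, g a * Real.cos (a * t)) ^ 2 +
    (∑ a ∈ Finset.range N, g a * Real.sin (a * t)) ^ 2

theorem trigNormSq_nonneg (N : ℕ) (g : ℤ → ℝ) (t : ℝ) : 0 ≤ trigNormSq N g t := by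
  unfold trigNormSq; positivity

/-- Expand as a double sum over `a, b`, collect by `n = a - b + 1`, and pair `n` with `-n`: `sin` is
odd and the autocorrelation even, so a difference appears. -/
theorem trigNormSq_mul_sin {N : ℕ} {g : ℤ → ℝ} (hg : SupportedBelow N g) (t : ℝ) :
    trigNormSq N g t * Real.sin t = ∑ j ∈ Finset.Icc 1 N,
      (autocorr g (j - 1) - autocorr g (j + 1)) * Real.sin ((j : ℝ) * t) := by
  have h1 : trigNormSq N g t * Real.sin t = ∑ b ∈ Finset.range N, ∑ a ∈ Finset.range N,
      g b * (g a * Real.sin (((a - b + 1 : ℤ) : ℝ) * t)) := by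
    have hswap : ∑ b ∈ Finset.range N, ∑ a ∈ Finset.range N,
        g b * (g a * Real.sin (((a - b + 1 : ℤ) : ℝ) * t)) = ∑ b ∈ Finset.range N,
        ∑ a ∈ Finset.range N, g a * (g b * Real.sin (((b - a + 1 : ℤ) : ℝ) * t)) :=
      Finset.sum_comm
    -- Symmetrizing in `a, b` uses `sin (t + φ) + sin (t - φ) = 2 sin t cos φ` with `φ = (a - b) t`.
    have hx : trigNormSq N g t * Real.sin t + trigNormSq N g t * Real.sin t =
        ∑ b ∈ Finset.range N, ∑ a ∈ Finset.range N,
          (g b * (g a * Real.sin (((a - b + 1 : ℤ) : ℝ) * t)) +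
            g a * (g b * Real.sin (((b - a + 1 : ℤ) : ℝ) * t))) := by
      rw [trigNormSq, sq, sq, Finset.sum_mul_sum, Finset.sum_mul_sum, ← Finset.sum_add_distrib,
        Finset.sum_mul, ← Finset.sum_add_distrib]
      refine Finset.sum_congr rfl fun b _ => ?_
      rw [← Finset.sum_add_distrib, Finset.sum_mul, ← Finset.sum_add_distrib]
      refine Finset.sum_congr rfl fun a _ => ?_
      have e1 : ((a - b + 1 : ℤ) : ℝ) * t = t + (a * t - b * t) := by push_cast; ring
      have e2 : ((b - a + 1 : ℤ) : ℝ) * t = t - (a * t - b * t) := by push_cast; ring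
      rw [e1, e2, Real.sin_add t, Real.sin_sub t, Real.cos_sub]
      ring
    simp only [Finset.sum_add_distrib] at hx
    linarith
  have h2 : ∀ b ∈ Finset.range N, ∑ a ∈ Finset.range N,
      g b * (g a * Real.sin (((a - b + 1 : ℤ) : ℝ) * t)) =
      ∑ n ∈ Finset.Icc (-(N : ℤ)) N, g b * g (b + (n - 1)) * Real.sin ((n : ℝ) * t) := by
    intro b hb
    rw [← Finset.mul_sum,
      sum_range_eq_sum_Icc hg (Finset.mem_range.1 hb) fun n => Real.sin ((n : ℝ) * t),
      Finset.mul_sum]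
    simp only [mul_assoc]
  rw [h1, Finset.sum_congr rfl h2, Finset.sum_comm]
  have h3 : ∀ n : ℤ, ∑ b ∈ Finset.range N, g b * g (b + (n - 1)) * Real.sin ((n : ℝ) * t) =
      autocorr g (n - 1) * Real.sin ((n : ℝ) * t) := fun n => by
    rw [autocorr, hg.tsum_mul fun i => g (i + (n - 1)), Finset.sum_mul]
  simp only [h3]
  rw [sum_Icc_neg_eq]
  simp only [Int.cast_zero, zero_mul, Real.sin_zero, mul_zero, zero_add]
  refine Finset.sum_congr rfl fun j _ => ?_
  rw [show (-(j : ℤ) - 1) = -((j : ℤ) + 1) by ring, autocorr_neg]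
  push_cast
  rw [neg_mul, Real.sin_neg]
  ring

theorem sum_autocorr_sub {N : ℕ} {g : ℤ → ℝ} (hg : SupportedBelow N g) :
    ∑ j ∈ Finset.Icc 1 N, (autocorr g ((j : ℤ) - 1) - autocorr g (j + 1)) =
      autocorr g 0 + autocorr g 1 := by
  have key : ∀ n : ℕ, ∑ j ∈ Finset.Icc 1 n,
      (autocorr g ((j : ℤ) - 1) - autocorr g (j + 1)) =
      autocorr g 0 + autocorr g 1 - autocorr g n - autocorr g (n + 1) := by
    intro n
    induction n with
    | zero => simp
    | succ n ih =>
      rw [Finset.sum_Icc_succ_top (by omega), ih]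
      push_cast
      rw [add_sub_cancel_right]
      ring
  rw [key, autocorr_eq_zero hg le_rfl, autocorr_eq_zero hg (k := N + 1) (by omega)]
  ring

open Polynomial in
/-- The coefficients of a polynomial as a sequence indexed by `ℤ`. -/
noncomputable def intCoeff (g : ℝ[X]) (i : ℤ) : ℝ := if 0 ≤ i then g.coeff i.toNat else 0

theorem supportedBelow_intCoeff {N : ℕ} {g : Polynomial ℝ} (hg : g.natDegree < N) :
    SupportedBelow N (intCoeff g) := by
  intro i hi
  unfold intCoeff
  split_ifs with h
  · refine Polynomial.coeff_eq_zero_of_natDegree_lt ?_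
    simp only [Set.mem_Ico, not_and, not_lt] at hi
    have := hi h
    omega
  · rfl

theorem normSq_aeval_exp {N : ℕ} {g : Polynomial ℝ} (hg : g.natDegree < N) (t : ℝ) :
    Complex.normSq (Polynomial.aeval (Complex.exp (t * Complex.I)) g) =
      trigNormSq N (intCoeff g) t := by
  have h : Polynomial.aeval (Complex.exp (t * Complex.I)) g =
      ∑ a ∈ Finset.range N, ((g.coeff a * Real.cos (a * t) : ℝ) +
        (g.coeff a * Real.sin (a * t) : ℝ) * Complex.I) := by
    rw [Polynomial.aeval_eq_sum_range' hg]
    refine Finset.sum_congr rfl fun a _ => ?_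
    rw [← Complex.exp_nat_mul, ← mul_assoc, Complex.exp_mul_I, Complex.real_smul]
    push_cast
    ring
  rw [h, Finset.sum_add_distrib, ← Finset.sum_mul, ← Complex.ofReal_sum, ← Complex.ofReal_sum,
    Complex.normSq_add_mul_I]
  simp [trigNormSq, intCoeff]

/-- Fejér-type description of the sine polynomials that are nonnegative on `[0, π]`. -/
theorem exists_list_autocorr {N : ℕ} (hN : 0 < N) {a : ℕ → ℝ}
    (ha : ∀ t ∈ Set.Icc (0 : ℝ) Real.pi, 0 ≤ ∑ j ∈ Finset.Icc 1 N, a j * Real.sin ((j : ℝ) * t)) :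
    ∃ l : List (ℤ → ℝ), (∀ g ∈ l, SupportedBelow N g) ∧ ∀ j ∈ Finset.Icc 1 N,
      a j = (l.map fun g => autocorr g ((j : ℤ) - 1) - autocorr g (j + 1)).sum := by
  have hnn : ∀ x ∈ Set.Icc (-1 : ℝ) 1, 0 ≤ (sineQuotient N a).eval x := by
    -- The hypothesis controls `sin t * p (cos t)`; one more factor `sin t` makes it polynomial in
    -- `cos t`. The value `x₀ = 1` is a dummy, since `1 - x²` has no interior zero.
    refine eval_nonneg_of_mul_nonneg (q := 1 - Polynomial.X ^ 2) (x₀ := 1) (fun x hx _ => ?_)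
      fun x hx => ?_
    · simp only [Polynomial.eval_sub, Polynomial.eval_one, Polynomial.eval_pow, Polynomial.eval_X]
      nlinarith [hx.1, hx.2]
    · have h := ha (Real.arccos x) ⟨Real.arccos_nonneg x, Real.arccos_le_pi x⟩
      have hx2 : 0 ≤ 1 - x ^ 2 := by nlinarith [hx.1, hx.2]
      rw [← sineQuotient_eval_cos, Real.cos_arccos hx.1 hx.2, Real.sin_arccos] at h
      have h' := mul_nonneg h (Real.sqrt_nonneg (1 - x ^ 2))
      rw [mul_assoc, Real.mul_self_sqrt hx2] at h'
      simpa [mul_comm] using h'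
  obtain ⟨l, hl, h⟩ := isSumNormSq_of_nonneg (N - 1) _ (natDegree_sineQuotient_le N a) hnn
  have hl' : ∀ g ∈ l, g.natDegree < N := fun g hg => by have := hl g hg; omega
  refine ⟨l.map intCoeff, ?_, ?_⟩
  · intro g hg
    obtain ⟨g', hg', rfl⟩ := List.mem_map.1 hg
    exact supportedBelow_intCoeff (hl' g' hg')
  · refine coeff_eq_of_sine_sum_eq
      (b := fun j => ((l.map intCoeff).map
        fun g => autocorr g ((j : ℤ) - 1) - autocorr g (j + 1)).sum) fun t => ?_
    rw [← sineQuotient_eval_cos, h t]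
    clear h hnn hl
    induction l with
    | nil => simp
    | cons g l ih =>
      simp only [List.map_cons, List.sum_cons, add_mul, Finset.sum_add_distrib]
      rw [ih fun g hg => hl' g (List.mem_cons_of_mem _ hg),
        normSq_aeval_exp (hl' g List.mem_cons_self),
        trigNormSq_mul_sin (supportedBelow_intCoeff (hl' g List.mem_cons_self))]

/-! ### Ground state substitution -/

/-- A positive sequence on `[0, N)` annihilated there by the band matrix of the quadratic form
`lam (d₀ - d₂) - (d₀ + d₁)`. -/
structure IsGroundState (N : ℕ) (lam : ℝ) (H : ℤ → ℝ) : Prop where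
  supp : SupportedBelow N H
  pos : ∀ i ∈ Set.Ico (0 : ℤ) N, 0 < H i
  lam_nonneg : 0 ≤ lam
  rec_eq : ∀ i ∈ Set.Ico (0 : ℤ) N,
    (lam - 1) * H i = (H (i + 1) + H (i - 1)) / 2 + lam * (H (i + 2) + H (i - 2)) / 2

namespace IsGroundState

variable {N : ℕ} {lam : ℝ} {H : ℤ → ℝ}

theorem nonneg (hH : IsGroundState N lam H) (i : ℤ) : 0 ≤ H i := by
  by_cases hi : i ∈ Set.Ico (0 : ℤ) N
  · exact (hH.pos i hi).le
  · exact (hH.supp i hi).ge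

/-- Expand the square and shift the `x (i + k) ^ 2` term by `k`; the cross term is the
autocorrelation of `H x`. -/
theorem tsum_sq_sub (hH : IsGroundState N lam H) (x : ℤ → ℝ) (k : ℤ) :
    ∑' i, H i * (H (i + k) * (x i - x (i + k)) ^ 2) =
      ∑' i, H i * (x i ^ 2 * (H (i + k) + H (i - k))) -
        2 * autocorr (fun i => H i * x i) k := by
  have h1 : ∑' i, H i * (x i ^ 2 * H (i - k)) = ∑' i, H i * (H (i + k) * x (i + k) ^ 2) := by
    rw [← tsum_add_right _ k]
    refine tsum_congr fun i => ?_
    rw [add_sub_cancel_right]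
    ring
  have h2 : ∑' i, H i * (x i ^ 2 * (H (i + k) + H (i - k))) =
      ∑' i, H i * (x i ^ 2 * H (i + k)) + ∑' i, H i * (H (i + k) * x (i + k) ^ 2) := by
    rw [← h1, ← (hH.supp.summable_mul _).tsum_add (hH.supp.summable_mul _)]
    exact tsum_congr fun i => by ring
  have h3 : autocorr (fun i => H i * x i) k = ∑' i, H i * (x i * (H (i + k) * x (i + k))) :=
    tsum_congr fun i => by ring
  rw [h2, h3, ← tsum_mul_left, ← (hH.supp.summable_mul _).tsum_add (hH.supp.summable_mul _)]
  have : ∀ i, 2 * (H i * (x i * (H (i + k) * x (i + k)))) =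
      H i * (2 * (x i * (H (i + k) * x (i + k)))) := fun i => by ring
  simp only [this, ← mul_add]
  rw [← (hH.supp.summable_mul _).tsum_sub (hH.supp.summable_mul _)]
  exact tsum_congr fun i => by ring

/-- Multiplying the recurrence by `H_i x_i²` and summing cancels the diagonal terms of `tsum_sq_sub`
for `k = 1, 2`, leaving only squares. -/
theorem quadratic_form_eq (hH : IsGroundState N lam H) (x : ℤ → ℝ) :
    lam * (autocorr (fun i => H i * x i) 0 - autocorr (fun i => H i * x i) 2) -
      (autocorr (fun i => H i * x i) 0 + autocorr (fun i => H i * x i) 1) =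
      (∑' i, H i * (H (i + 1) * (x i - x (i + 1)) ^ 2)) / 2 +
        lam * (∑' i, H i * (H (i + 2) * (x i - x (i + 2)) ^ 2)) / 2 := by
  rw [hH.tsum_sq_sub x 1, hH.tsum_sq_sub x 2]
  have h0 : (lam - 1) * autocorr (fun i => H i * x i) 0 =
      (∑' i, H i * (x i ^ 2 * (H (i + 1) + H (i - 1)))) / 2 +
        lam / 2 * (∑' i, H i * (x i ^ 2 * (H (i + 2) + H (i - 2)))) := by
    rw [autocorr, ← tsum_mul_left, ← tsum_mul_left, ← tsum_div_const,
      ← ((hH.supp.summable_mul _).div_const _).tsum_add ((hH.supp.summable_mul _).mul_left _)]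
    refine tsum_congr fun i => ?_
    by_cases hi : i ∈ Set.Ico (0 : ℤ) N
    · rw [add_zero]
      linear_combination (H i * x i ^ 2) * hH.rec_eq i hi
    · simp [hH.supp i hi]
  linear_combination h0

theorem eq_mul_div (hH : IsGroundState N lam H) {g : ℤ → ℝ} (hg : SupportedBelow N g) :
    g = fun i => H i * (g i / H i) := by
  funext i
  by_cases hi : i ∈ Set.Ico (0 : ℤ) N
  · rw [mul_div_cancel₀ _ (hH.pos i hi).ne']
  · rw [hg i hi, zero_div, mul_zero]

theorem tsum_sq_nonneg (hH : IsGroundState N lam H) (x : ℤ → ℝ) (k : ℤ) :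
    0 ≤ ∑' i, H i * (H (i + k) * (x i - x (i + k)) ^ 2) :=
  tsum_nonneg fun i =>
    mul_nonneg (hH.nonneg i) (mul_nonneg (hH.nonneg _) (sq_nonneg _))

/-- The maximal Rayleigh quotient is `lam`. -/
theorem autocorr_le (hH : IsGroundState N lam H) {g : ℤ → ℝ} (hg : SupportedBelow N g) :
    autocorr g 0 + autocorr g 1 ≤ lam * (autocorr g 0 - autocorr g 2) := by
  rw [hH.eq_mul_div hg, ← sub_nonneg, hH.quadratic_form_eq]
  have h1 := hH.tsum_sq_nonneg (fun i => g i / H i) 1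
  have h2 := mul_nonneg hH.lam_nonneg (hH.tsum_sq_nonneg (fun i => g i / H i) 2)
  linarith

/-- The maximal Rayleigh quotient is attained only at multiples of the ground state. -/
theorem eq_smul_of_autocorr_eq (hH : IsGroundState N lam H) {g : ℤ → ℝ}
    (hg : SupportedBelow N g)
    (h : autocorr g 0 + autocorr g 1 = lam * (autocorr g 0 - autocorr g 2)) :
    ∃ c : ℝ, g = fun i => c * H i := by
  set x : ℤ → ℝ := fun i => g i / H i with hx
  have hgx : g = fun i => H i * x i := hH.eq_mul_div hg
  have hq := hH.quadratic_form_eq x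
  rw [← hgx, h, sub_self] at hq
  have h1 := hH.tsum_sq_nonneg x 1
  have h2 := mul_nonneg hH.lam_nonneg (hH.tsum_sq_nonneg x 2)
  have h0 : ∑' i, H i * (H (i + 1) * (x i - x (i + 1)) ^ 2) = 0 := by linarith
  have hs := (hH.supp.summable_mul fun i => H (i + 1) * (x i - x (i + 1)) ^ 2).hasSum
  rw [h0, hasSum_zero_iff_of_nonneg fun i => mul_nonneg (hH.nonneg i)
    (mul_nonneg (hH.nonneg _) (sq_nonneg _))] at hs
  -- The nearest-neighbour squares alone connect all of `[0, N)`, because `H` is positive there.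
  have hconst : ∀ n : ℕ, n < N → x n = x 0 := by
    intro n
    induction n with
    | zero => intro _; rfl
    | succ n ih =>
      intro hn
      have hz := congrFun hs n
      have p1 := hH.pos n (by simp; omega)
      have p2 := hH.pos (n + 1) (by simp; omega)
      have : (x n - x (n + 1)) ^ 2 = 0 := by
        rcases mul_eq_zero.1 hz with h | h
        · exact absurd h p1.ne'
        · exact (mul_eq_zero.1 h).resolve_left p2.ne'
      have := sub_eq_zero.1 (pow_eq_zero_iff two_ne_zero |>.1 this)
      push_cast
      rw [← this, ih (by omega)]
  refine ⟨x 0, ?_⟩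
  conv_lhs => rw [hgx]
  funext i
  by_cases hi : i ∈ Set.Ico (0 : ℤ) N
  · obtain ⟨n, rfl⟩ := Int.eq_ofNat_of_zero_le hi.1
    rw [hconst n (by simpa using hi.2), mul_comm]
  · simp [hH.supp i hi]

theorem autocorr_eq (hH : IsGroundState N lam H) :
    autocorr H 0 + autocorr H 1 = lam * (autocorr H 0 - autocorr H 2) := by
  have h := hH.quadratic_form_eq fun _ => 1
  simp only [mul_one, sub_self, ne_eq, OfNat.ofNat_ne_zero, not_false_eq_true, zero_pow,
    mul_zero, tsum_zero, zero_div, add_zero] at h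
  linarith

end IsGroundState

/-! ### Positivity of the autocorrelation differences -/

/-- A finitely supported sequence that is symmetric and decreasing away from its centre has
positive autocorrelation differences. -/
theorem autocorr_sub_pos {N : ℕ} {H : ℤ → ℝ} (hs : SupportedBelow N H)
    (hpos : ∀ i ∈ Set.Ico (0 : ℤ) N, 0 < H i)
    (hmono : ∀ a b : ℤ, |2 * a - (N - 1)| ≤ |2 * b - (N - 1)| → H b ≤ H a)
    {k : ℤ} (hk0 : 0 ≤ k) (hk : k < N) : 0 < autocorr H k - autocorr H (k + 2) := by
  have s1 : ∀ m : ℤ, Summable fun l => H l * H (l - m) := fun m => hs.summable_mul _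
  have s2 : ∀ m : ℤ, Summable fun l => H (l + 2) * H (l - m) := fun m => by
    have := (hs.summable_mul fun l => H (l + m + 2)).comp_injective
      (Equiv.subRight m).injective
    refine this.congr fun l => ?_
    simp [Function.comp, mul_comm]
  have e1 : ∀ m : ℤ, ∑' l, H l * H (l - m) = autocorr H m := fun m => by
    rw [← autocorr_neg]; rfl
  have e2 : ∀ m : ℤ, ∑' l, H (l + 2) * H (l - m) = autocorr H (m + 2) := fun m => by
    rw [← autocorr_neg, autocorr,
      ← tsum_add_right (fun i => H i * H (i + -(m + 2))) 2]
    refine tsum_congr fun l => ?_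
    congr 2
    ring
  set δ : ℤ → ℝ := fun l => H l - H (l + 2) with hδ
  have sδ : ∀ m : ℤ, Summable fun l => δ l * H (l - m) := fun m =>
    ((s1 m).sub (s2 m)).congr fun l => by simp only [hδ]; ring
  have eδ : ∀ m : ℤ, ∑' l, δ l * H (l - m) = autocorr H m - autocorr H (m + 2) := fun m => by
    rw [← e1, ← e2, ← (s1 m).tsum_sub (s2 m)]
    exact tsum_congr fun l => by simp only [hδ]; ring
  have eneg : autocorr H (-k - 2) - autocorr H (-k) = autocorr H (k + 2) - autocorr H k := by
    rw [show -k - 2 = -(k + 2) by ring, autocorr_neg, autocorr_neg]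
  -- Shifts `k` and `-k - 2` give opposite values of the difference. In the resulting products, the
  -- pairs `l, l + 2` and `l - k, l + k + 2` share the midpoint `l + 1`, so both factors have the
  -- same sign.
  have htwo : 2 * (autocorr H k - autocorr H (k + 2)) =
      ∑' l, δ l * (H (l - k) - H (l - (-k - 2))) := by
    simp only [mul_sub]
    rw [(sδ _).tsum_sub (sδ _), eδ, eδ, show -k - 2 + 2 = -k by ring, eneg]
    ring
  have hpos' : 0 < ∑' l, δ l * (H (l - k) - H (l - (-k - 2))) := by
    refine Summable.tsum_pos ?_ (fun l => ?_) ((N : ℤ) - 1) ?_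
    · simp only [mul_sub]
      exact (sδ _).sub (sδ _)
    · rcases le_total ((N : ℤ) - 1) (2 * (l + 1)) with h | h
      · refine mul_nonneg (sub_nonneg.2 (hmono _ _ ?_)) (sub_nonneg.2 (hmono _ _ ?_)) <;>
          rw [abs_le] <;> constructor <;> cases abs_cases (2 * (l + 2) - ((N : ℤ) - 1)) <;>
          cases abs_cases (2 * (l - (-k - 2)) - ((N : ℤ) - 1)) <;> omega
      · refine mul_nonneg_of_nonpos_of_nonpos (sub_nonpos.2 (hmono _ _ ?_))
          (sub_nonpos.2 (hmono _ _ ?_)) <;>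
          rw [abs_le] <;> constructor <;> cases abs_cases (2 * l - ((N : ℤ) - 1)) <;>
          cases abs_cases (2 * (l - k) - ((N : ℤ) - 1)) <;> omega
    -- At `l = N - 1` both subtracted values fall outside the support, so this term is strictly
    -- positive.
    · have z1 : H ((N : ℤ) - 1 + 2) = 0 := hs _ (by simp; omega)
      have z2 : H ((N : ℤ) - 1 - (-k - 2)) = 0 := hs _ (by simp; omega)
      simp only [hδ]
      rw [z1, z2, sub_zero, sub_zero]
      exact mul_pos (hpos _ (by simp; omega)) (hpos _ (by simp; omega))
  linarith

/-! ### The explicit ground state for even `N` -/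

/-- The angle at which the explicit ground state satisfies its boundary conditions. -/
theorem exists_angle {m : ℝ} (hm : 1 ≤ m) :
    ∃ θ : ℝ, 0 < θ ∧ θ < Real.pi ∧ (m + 1 / 2) * θ ≤ Real.pi ∧
      (m + 1) * Real.cos (m * θ) + m * Real.cos ((m + 1) * θ) = 0 := by
  have hpi := Real.pi_pos
  have hab : Real.pi / (2 * (m + 1)) ≤ Real.pi / (2 * m) := by gcongr; linarith
  have ha : (m + 1) * (Real.pi / (2 * (m + 1))) = Real.pi / 2 := by field_simp
  have hb : m * (Real.pi / (2 * m)) = Real.pi / 2 := by field_simp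
  have hb' : (m + 1) * (Real.pi / (2 * m)) = Real.pi / 2 + Real.pi / (2 * m) := by
    rw [add_mul, one_mul, hb]
  have hapos : 0 < Real.pi / (2 * (m + 1)) := by positivity
  have hbpos : 0 < Real.pi / (2 * m) := by positivity
  have hb2 : Real.pi / (2 * m) ≤ Real.pi / 2 := by gcongr; linarith
  -- Each endpoint kills one of the two cosines, and the surviving terms have opposite weak signs.
  obtain ⟨θ, ⟨h1, h2⟩, h⟩ := intermediate_value_Icc' hab
    (f := fun θ => (m + 1) * Real.cos (m * θ) + m * Real.cos ((m + 1) * θ))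
    (by fun_prop) (show (0 : ℝ) ∈ _ from by
      refine ⟨?_, ?_⟩
      · rw [hb, hb', Real.cos_pi_div_two, mul_zero, zero_add]
        refine mul_nonpos_of_nonneg_of_nonpos (by linarith)
          (Real.cos_nonpos_of_pi_div_two_le_of_le ?_ ?_) <;> linarith
      · rw [ha, Real.cos_pi_div_two, mul_zero, add_zero]
        refine mul_nonneg (by linarith) (Real.cos_nonneg_of_neg_pi_div_two_le_of_le ?_ ?_)
        · have : 0 ≤ m * (Real.pi / (2 * (m + 1))) := by positivity
          linarith
        · linarith [mul_le_mul_of_nonneg_right (by linarith : m ≤ m + 1) hapos.le])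
  refine ⟨θ, by linarith, by linarith, ?_, h⟩
  have := mul_le_mul_of_nonneg_left h2 (by linarith : 0 ≤ m)
  linarith

/-- The explicit solution of the band recurrence, symmetric about `M - 1 / 2`. -/
noncomputable def explicitSol (M : ℕ) (θ β : ℝ) (k : ℤ) : ℝ :=
  Real.cos (((k : ℝ) - M + 1 / 2) * θ) + β * (-1 : ℝ) ^ k * ((k : ℝ) - M + 1 / 2)

/-- Since `2 * M - 1` is odd, reflection flips the sign of both `(-1)^k` and the linear factor. This
is where the parity of `N` enters. -/
theorem explicitSol_symm (M : ℕ) (θ β : ℝ) (k : ℤ) :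
    explicitSol M θ β (2 * M - 1 - k) = explicitSol M θ β k := by
  have h1 : (-1 : ℝ) ^ (2 * (M : ℤ) - 1 - k) = -(-1 : ℝ) ^ k := by
    rw [zpow_sub₀ (by norm_num), zpow_sub₀ (by norm_num), zpow_mul]
    rcases Int.even_or_odd k with h | h <;> simp [h.neg_one_zpow]
  unfold explicitSol
  rw [h1, ← Real.cos_neg]
  push_cast
  ring_nf

/-- With `c = (z + z⁻¹) / 2` the characteristic equation is `(1 + c) (2 lam (1 - c) - 1) = 0`: the
first factor gives the double root `z = -1`, the second gives `z = e^{±iθ}`. -/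
theorem explicitSol_rec (M : ℕ) {θ lam : ℝ} (β : ℝ) (k : ℤ)
    (h : lam * (2 * (1 - Real.cos θ)) = 1) :
    (lam - 1) * explicitSol M θ β k =
      (explicitSol M θ β (k + 1) + explicitSol M θ β (k - 1)) / 2 +
        lam * (explicitSol M θ β (k + 2) + explicitSol M θ β (k - 2)) / 2 := by
  have hz : (-1 : ℝ) ≠ 0 := by norm_num
  unfold explicitSol
  rw [zpow_add₀ hz, zpow_add₀ hz, zpow_sub₀ hz, zpow_sub₀ hz]
  push_cast
  set u : ℝ := (k : ℝ) - M + 1 / 2 with hu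
  rw [show (k : ℝ) + 1 - M + 1 / 2 = u + 1 by rw [hu]; ring,
    show (k : ℝ) - 1 - M + 1 / 2 = u - 1 by rw [hu]; ring,
    show (k : ℝ) + 2 - M + 1 / 2 = u + 2 by rw [hu]; ring,
    show (k : ℝ) - 2 - M + 1 / 2 = u - 2 by rw [hu]; ring,
    show (u + 1) * θ = u * θ + θ by ring, show (u - 1) * θ = u * θ - θ by ring,
    show (u + 2) * θ = u * θ + 2 * θ by ring, show (u - 2) * θ = u * θ - 2 * θ by ring]
  simp only [Real.cos_add, Real.cos_sub, Real.cos_two_mul]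
  norm_num
  linear_combination (1 + Real.cos θ) * Real.cos (u * θ) * h

theorem explicitSol_sub (M : ℕ) (θ β : ℝ) (k : ℤ) :
    explicitSol M θ β k - explicitSol M θ β (k + 1) =
      2 * Real.sin (((k : ℝ) - M + 1) * θ) * Real.sin (θ / 2) +
        β * (-1 : ℝ) ^ k * (2 * ((k : ℝ) - M + 1)) := by
  unfold explicitSol
  rw [zpow_add₀ (by norm_num)]
  push_cast
  rw [show ((k : ℝ) - M + 1 / 2) * θ = ((k : ℝ) - M + 1) * θ - θ / 2 by ring,
    show ((k : ℝ) + 1 - M + 1 / 2) * θ = ((k : ℝ) - M + 1) * θ + θ / 2 by ring,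
    Real.cos_sub, Real.cos_add]
  ring

theorem mul_sin_lt_sin_mul {s x : ℝ} (hs0 : 0 < s) (hs1 : s < 1) (hx0 : 0 < x)
    (hx : x ≤ Real.pi) : s * Real.sin x < Real.sin (s * x) := by
  have := strictConcaveOn_sin_Icc.2 ⟨le_rfl, Real.pi_pos.le⟩ ⟨hx0.le, hx⟩ hx0.ne
    (sub_pos.2 hs1) hs0 (by ring)
  simpa using this

theorem exists_isGroundState {M : ℕ} (hM : 0 < M) :
    ∃ lam H, IsGroundState (2 * M) lam H ∧ ∀ a b : ℤ,
      |2 * a - (((2 * M : ℕ) : ℤ) - 1)| ≤ |2 * b - (((2 * M : ℕ) : ℤ) - 1)| → H b ≤ H a := by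
  have hM1 : (1 : ℝ) ≤ M := by exact_mod_cast hM
  obtain ⟨θ, hθ0, hθpi, hθ, hθeq⟩ := exists_angle (m := (M : ℝ) + 1 / 2) (by linarith)
  have hcos : Real.cos θ < 1 := by
    rw [← Real.cos_zero]
    exact Real.cos_lt_cos_of_nonneg_of_le_pi le_rfl hθpi.le hθ0
  have hsin : 0 < Real.sin (θ / 2) := Real.sin_pos_of_pos_of_lt_pi (by linarith) (by linarith)
  -- This `β` gives vanishing at `2M`; the equation for `θ` is what remains after eliminating `β`
  -- from vanishing at `2M + 1`. Symmetry then covers `-1` and `-2`.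
  set β : ℝ := -Real.cos (((M : ℝ) + 1 / 2) * θ) / ((M : ℝ) + 1 / 2) with hβ
  have hβ1 : Real.cos (((M : ℝ) + 1 / 2) * θ) + β * ((M : ℝ) + 1 / 2) = 0 := by
    rw [hβ]; field_simp; ring
  have hβ2 : Real.cos (((M : ℝ) + 3 / 2) * θ) - β * ((M : ℝ) + 3 / 2) = 0 := by
    rw [show (M : ℝ) + 1 / 2 + 1 = M + 3 / 2 by ring] at hθeq
    have hne : (M : ℝ) + 1 / 2 ≠ 0 := by positivity
    refine (mul_eq_zero.1 ?_).resolve_left hne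
    linear_combination hθeq - ((M : ℝ) + 3 / 2) * hβ1
  set h := explicitSol M θ β with hdef
  have hsymm : ∀ k, h (2 * M - 1 - k) = h k := explicitSol_symm M θ β
  have hN0 : h (2 * M) = 0 := by
    rw [hdef, explicitSol, zpow_mul]
    push_cast
    rw [show (2 : ℝ) * M - M + 1 / 2 = M + 1 / 2 by ring]
    simpa using hβ1
  have hN1 : h (2 * M + 1) = 0 := by
    rw [hdef, explicitSol, zpow_add₀ (by norm_num), zpow_mul]
    push_cast
    rw [show (2 : ℝ) * M + 1 - M + 1 / 2 = M + 3 / 2 by ring]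
    simpa [sub_eq_add_neg] using hβ2
  have hm1 : h (-1) = 0 := by rw [← hsymm, ← hN0]; congr 1; ring
  have hm2 : h (-2) = 0 := by rw [← hsymm, ← hN1]; congr 1; ring
  -- The difference formula at `k = 2M`, where both values vanish, expresses `β` through a sine.
  have hβv : Real.sin (((M : ℝ) + 1) * θ) * Real.sin (θ / 2) = -β * (M + 1) := by
    have := explicitSol_sub M θ β (2 * M)
    rw [← hdef, hN0, hN1, zpow_mul] at this
    push_cast at this
    rw [show (2 : ℝ) * M - M + 1 = M + 1 by ring] at this
    norm_num at this
    linarith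
  have hβ0 : β ≤ 0 := by
    have h1 : 0 ≤ Real.sin (((M : ℝ) + 1) * θ) :=
      Real.sin_nonneg_of_nonneg_of_le_pi (by positivity) (by linarith)
    have h2 := mul_nonneg h1 hsin.le
    rw [hβv] at h2
    nlinarith
  -- With `v = k - M + 1 < M + 1`, strict concavity of `sin` on `[0, π]` gives `sin (vθ) sin (θ/2) >
  -- -β v`, which dominates the alternating term whatever its sign. The bound `(M + 1) θ ≤ π` is
  -- needed here.
  have hdec : ∀ k : ℤ, M ≤ k → k < 2 * M → h (k + 1) < h k := by
    intro k hk1 hk2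
    have hk1' : (M : ℝ) ≤ k := by exact_mod_cast hk1
    have hk2' : (k : ℝ) + 1 ≤ 2 * M := by exact_mod_cast hk2
    set v : ℝ := (k : ℝ) - M + 1 with hv
    have hv0 : 0 < v := by linarith
    have h1 := mul_sin_lt_sin_mul (s := v / (M + 1)) (x := ((M : ℝ) + 1) * θ) (by positivity)
      (by rw [div_lt_one (by positivity)]; linarith) (by positivity) (by linarith)
    rw [show v / ((M : ℝ) + 1) * (((M : ℝ) + 1) * θ) = v * θ by field_simp] at h1
    have h2 := mul_lt_mul_of_pos_right h1 hsin
    rw [mul_assoc, hβv, show v / ((M : ℝ) + 1) * (-β * (M + 1)) = -β * v by field_simp] at h2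
    rw [← sub_pos, hdef, explicitSol_sub, ← hv]
    rcases Int.even_or_odd k with he | ho
    · rw [he.neg_one_zpow]; linarith
    · rw [ho.neg_one_zpow]
      have := mul_nonneg (neg_nonneg.2 hβ0) hv0.le
      linarith
  have hposr : ∀ n : ℕ, n < M → 0 < h (2 * M - 1 - n) := by
    intro n
    induction n with
    | zero =>
      intro _
      have := hdec (2 * M - 1) (by omega) (by omega)
      rw [sub_add_cancel, hN0] at this
      simpa using this
    | succ n ih =>
      intro hn
      have := hdec (2 * M - 1 - (n + 1 : ℕ)) (by omega) (by omega)
      refine (ih (by omega)).trans ?_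
      rwa [show (2 * M - 1 - (n + 1 : ℕ) + 1 : ℤ) = 2 * M - 1 - n by push_cast; ring] at this
  have hpos1 : ∀ k : ℤ, M ≤ k → k < 2 * M → 0 < h k := by
    intro k hk1 hk2
    have := hposr (2 * M - 1 - k).toNat (by omega)
    rwa [show (2 * M - 1 - ((2 * M - 1 - k).toNat : ℤ) : ℤ) = k by omega] at this
  have hpos : ∀ k : ℤ, 0 ≤ k → k < 2 * M → 0 < h k := by
    intro k hk1 hk2
    rcases le_or_gt (M : ℤ) k with hk | hk
    · exact hpos1 k hk hk2
    · rw [← hsymm]; exact hpos1 _ (by omega) (by omega)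
  set H : ℤ → ℝ := fun k => if 0 ≤ k ∧ k < 2 * M then h k else 0 with hH
  have hHin : ∀ k : ℤ, 0 ≤ k → k < 2 * M → H k = h k := fun k h1 h2 => if_pos ⟨h1, h2⟩
  have hHout : ∀ k : ℤ, ¬ (0 ≤ k ∧ k < 2 * M) → H k = 0 := fun k hk => if_neg hk
  -- The recurrence reaches two steps beyond the support, so truncation preserves it thanks to the
  -- four boundary zeros.
  have hHh : ∀ k : ℤ, -2 ≤ k → k < 2 * M + 2 → H k = h k := by
    intro k h1 h2
    by_cases hk : 0 ≤ k ∧ k < 2 * M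
    · exact hHin k hk.1 hk.2
    · rw [hHout k hk]
      obtain rfl | rfl | rfl | rfl : k = -2 ∨ k = -1 ∨ k = 2 * M ∨ k = 2 * M + 1 := by omega
      exacts [hm2.symm, hm1.symm, hN0.symm, hN1.symm]
  have hHsymm : ∀ k : ℤ, H (2 * M - 1 - k) = H k := by
    intro k
    by_cases hk : 0 ≤ k ∧ k < 2 * M
    · rw [hHin k hk.1 hk.2, hHin _ (by omega) (by omega), hsymm]
    · rw [hHout k hk, hHout _ (by omega)]
  have hHanti : ∀ a b : ℤ, (M : ℤ) ≤ a → a ≤ b → H b ≤ H a := by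
    intro a b ha hab
    induction b, hab using Int.leInduction with
    | base => exact le_rfl
    | succ b hab ih =>
      refine le_trans ?_ ih
      rcases lt_or_ge b (2 * M) with hb | hb
      · rw [hHh b (by omega) (by omega), hHh (b + 1) (by omega) (by omega)]
        exact (hdec b (by omega) hb).le
      · rw [hHout b (by omega), hHout (b + 1) (by omega)]
  refine ⟨1 / (2 * (1 - Real.cos θ)), H, ⟨?_, ?_, ?_, ?_⟩, ?_⟩
  · intro k hk
    exact hHout k (by simpa using hk)
  · intro k hk
    simp only [Nat.cast_mul, Nat.cast_ofNat, Set.mem_Ico] at hk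
    rw [hHin k hk.1 hk.2]
    exact hpos k hk.1 hk.2
  · have : 0 < 1 - Real.cos θ := by linarith
    positivity
  · intro k hk
    simp only [Nat.cast_mul, Nat.cast_ofNat, Set.mem_Ico] at hk
    rw [hHh k, hHh (k + 1), hHh (k - 1), hHh (k + 2), hHh (k - 2)] <;> try omega
    exact explicitSol_rec M β k (one_div_mul_cancel (by linarith))
  · have hrefl : ∀ a : ℤ, ∃ a' : ℤ, M ≤ a' ∧ H a' = H a ∧
        2 * a' - (2 * M - 1) = |2 * a - (2 * M - 1)| := by
      intro a
      rcases le_or_gt (M : ℤ) a with ha | ha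
      · exact ⟨a, ha, rfl, by rw [abs_of_nonneg (by omega)]⟩
      · exact ⟨2 * M - 1 - a, by omega, hHsymm a, by rw [abs_of_nonpos (by omega)]; ring⟩
    intro a b hab
    push_cast at hab
    obtain ⟨a', ha1, ha2, ha3⟩ := hrefl a
    obtain ⟨b', hb1, hb2, hb3⟩ := hrefl b
    rw [← ha2, ← hb2]
    exact hHanti a' b' ha1 (by omega)

/-! ### Extremality, uniqueness and positivity -/

namespace IsGroundState

variable {N : ℕ} {lam : ℝ} {H : ℤ → ℝ}

theorem sum_map_autocorr_le (hH : IsGroundState N lam H) (l : List (ℤ → ℝ))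
    (hl : ∀ g ∈ l, SupportedBelow N g) :
    (l.map fun g => autocorr g 0 + autocorr g 1).sum ≤
      lam * (l.map fun g => autocorr g 0 - autocorr g 2).sum := by
  rw [← List.sum_map_mul_left]
  exact List.sum_le_sum fun g hg => hH.autocorr_le (hl g hg)

/-- Every summand obeys the Rayleigh bound, so equality in total forces equality in each. All
summands are then multiples of `H`, and only one scale `s`, the sum of the squared factors,
survives. -/
theorem exists_autocorr_eq_of_sum_map_eq (hH : IsGroundState N lam H) (l : List (ℤ → ℝ))
    (hl : ∀ g ∈ l, SupportedBelow N g)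
    (h : (l.map fun g => autocorr g 0 + autocorr g 1).sum =
      lam * (l.map fun g => autocorr g 0 - autocorr g 2).sum) :
    ∃ s : ℝ, ∀ p q : ℤ, (l.map fun g => autocorr g p - autocorr g q).sum =
      s * (autocorr H p - autocorr H q) := by
  induction l with
  | nil => exact ⟨0, by simp⟩
  | cons g l ih =>
    have hl' : ∀ g ∈ l, SupportedBelow N g := fun f hf => hl f (List.mem_cons_of_mem _ hf)
    have h1 := hH.autocorr_le (hl g List.mem_cons_self)
    have h2 := hH.sum_map_autocorr_le l hl'
    simp only [List.map_cons, List.sum_cons, mul_add] at h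
    obtain ⟨s, hs⟩ := ih hl' (by linarith)
    obtain ⟨c, rfl⟩ := hH.eq_smul_of_autocorr_eq (hl g List.mem_cons_self) (by linarith)
    have hc : ∀ k, autocorr (fun i => c * H i) k = c ^ 2 * autocorr H k := fun k => by
      rw [autocorr, autocorr, ← tsum_mul_left]
      exact tsum_congr fun i => by ring
    refine ⟨c ^ 2 + s, fun p q => ?_⟩
    rw [List.map_cons, List.sum_cons, hs, hc, hc]
    ring

end IsGroundState

theorem coeffSum_eq_of_autocorr {N : ℕ} {F : Polynomial ℝ} {l : List (ℤ → ℝ)}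
    (hl : ∀ g ∈ l, SupportedBelow N g)
    (h : ∀ j ∈ Finset.Icc 1 N, F.coeff j =
      (l.map fun g => autocorr g ((j : ℤ) - 1) - autocorr g (j + 1)).sum) :
    coeffSum N F = (l.map fun g => autocorr g 0 + autocorr g 1).sum := by
  rw [coeffSum, Finset.sum_congr rfl h]
  clear h
  induction l with
  | nil => simp
  | cons g l ih =>
    simp only [List.map_cons, List.sum_cons, Finset.sum_add_distrib]
    rw [ih fun f hf => hl f (List.mem_cons_of_mem _ hf),
      sum_autocorr_sub (hl g List.mem_cons_self)]

/-- The polynomial whose coefficients are the autocorrelation differences of `H`, normalized. -/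
noncomputable def autocorrPoly (N : ℕ) (H : ℤ → ℝ) : Polynomial ℝ :=
  ∑ j ∈ Finset.Icc 1 N, Polynomial.monomial j
    ((autocorr H ((j : ℤ) - 1) - autocorr H (j + 1)) / (autocorr H 0 - autocorr H 2))

theorem autocorrPoly_coeff (N : ℕ) (H : ℤ → ℝ) (j : ℕ) : (autocorrPoly N H).coeff j =
    if j ∈ Finset.Icc 1 N then
      (autocorr H ((j : ℤ) - 1) - autocorr H (j + 1)) / (autocorr H 0 - autocorr H 2)
    else 0 := by
  simp [autocorrPoly, Polynomial.coeff_monomial]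

theorem autocorrPoly_mem_feasibleSet {N : ℕ} (hN : 0 < N) {H : ℤ → ℝ} (hs : SupportedBelow N H)
    (hpos : 0 < autocorr H 0 - autocorr H 2) : autocorrPoly N H ∈ feasibleSet N := by
  refine ⟨?_, ?_, ?_, fun t ht => ?_⟩
  · refine Polynomial.natDegree_sum_le_of_forall_le _ _ fun j hj => ?_
    exact (Polynomial.natDegree_monomial_le _).trans (Finset.mem_Icc.1 hj).2
  · rw [autocorrPoly_coeff, if_neg (by simp)]
  · rw [autocorrPoly_coeff, if_pos (by simp; omega)]
    norm_num
    exact hpos.ne'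
  · have : sinePoly N (autocorrPoly N H) t =
        trigNormSq N H t * Real.sin t / (autocorr H 0 - autocorr H 2) := by
      rw [trigNormSq_mul_sin hs, sinePoly, Finset.sum_div]
      refine Finset.sum_congr rfl fun j hj => ?_
      rw [autocorrPoly_coeff, if_pos hj]
      ring
    rw [this]
    exact div_nonneg (mul_nonneg (trigNormSq_nonneg N H t)
      (Real.sin_nonneg_of_nonneg_of_le_pi ht.1 ht.2)) hpos.le

theorem coeffSum_autocorrPoly {N : ℕ} {lam : ℝ} {H : ℤ → ℝ} (hH : IsGroundState N lam H)
    (hpos : 0 < autocorr H 0 - autocorr H 2) : coeffSum N (autocorrPoly N H) = lam := by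
  have : coeffSum N (autocorrPoly N H) =
      (autocorr H 0 + autocorr H 1) / (autocorr H 0 - autocorr H 2) := by
    rw [← sum_autocorr_sub hH.supp, coeffSum, Finset.sum_div]
    refine Finset.sum_congr rfl fun j hj => ?_
    rw [autocorrPoly_coeff, if_pos hj]
  rw [this, hH.autocorr_eq, mul_div_cancel_right₀ _ hpos.ne']

theorem theorem4p3 (N : ℕ) (hN : Even N) (hN0 : 0 < N) :
    ∃ F : Polynomial ℝ, IsExtremal N F ∧ (∀ G : Polynomial ℝ, IsExtremal N G → G = F) ∧
      ∀ k ∈ Finset.Icc 1 N, 0 < F.coeff k := by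
  obtain ⟨M, rfl⟩ := hN.two_dvd
  obtain ⟨lam, H, hH, hmono⟩ := exists_isGroundState (M := M) (by omega)
  have hdiff : ∀ k : ℤ, 0 ≤ k → k < (2 * M : ℕ) → 0 < autocorr H k - autocorr H (k + 2) :=
    fun k h0 h1 => autocorr_sub_pos hH.supp hH.pos hmono h0 h1
  have hpos : 0 < autocorr H 0 - autocorr H 2 := by
    simpa using hdiff 0 le_rfl (by exact_mod_cast hN0)
  have hone : (1 : ℕ) ∈ Finset.Icc 1 (2 * M) := by simp; omega
  have hnorm : ∀ {l : List (ℤ → ℝ)} {G : Polynomial ℝ}, G.coeff 1 = 1 →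
      (∀ j ∈ Finset.Icc 1 (2 * M), G.coeff j =
        (l.map fun g => autocorr g ((j : ℤ) - 1) - autocorr g (j + 1)).sum) →
      (l.map fun g => autocorr g 0 - autocorr g 2).sum = 1 := by
    intro l G h1 hl
    have := hl 1 hone
    rw [h1] at this
    norm_num at this
    exact this.symm
  have hF : IsExtremal (2 * M) (autocorrPoly (2 * M) H) := by
    refine ⟨autocorrPoly_mem_feasibleSet hN0 hH.supp hpos, isMaxOn_iff.2 fun G hG => ?_⟩
    obtain ⟨l, hl, hlG⟩ := exists_list_autocorr hN0 hG.2.2.2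
    rw [coeffSum_autocorrPoly hH hpos, coeffSum_eq_of_autocorr hl hlG]
    have := hH.sum_map_autocorr_le l hl
    rwa [hnorm hG.2.2.1 hlG, mul_one] at this
  refine ⟨autocorrPoly (2 * M) H, hF, fun G hG => ?_, fun k hk => ?_⟩
  · have hG' := hG.1
    obtain ⟨l, hl, hlG⟩ := exists_list_autocorr hN0 hG'.2.2.2
    have hsum := le_antisymm (isMaxOn_iff.1 hF.2 G hG.1) (isMaxOn_iff.1 hG.2 _ hF.1)
    rw [coeffSum_autocorrPoly hH hpos, coeffSum_eq_of_autocorr hl hlG] at hsum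
    have h1 := hnorm hG'.2.2.1 hlG
    obtain ⟨s, hs⟩ := hH.exists_autocorr_eq_of_sum_map_eq l hl (by rw [h1, hsum, mul_one])
    -- The normalization `α₁ = 1` fixes the one remaining scale.
    have hs1 : s = 1 / (autocorr H 0 - autocorr H 2) := by
      rw [hs] at h1
      exact eq_div_of_mul_eq hpos.ne' h1
    ext j
    rw [autocorrPoly_coeff]
    split_ifs with hj
    · rw [hlG j hj, hs, hs1]
      ring
    · rcases Nat.eq_zero_or_pos j with rfl | hj0
      · exact hG'.2.1
      · refine Polynomial.coeff_eq_zero_of_natDegree_lt (hG'.1.trans_lt ?_)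
        simp only [Finset.mem_Icc, not_and, not_le] at hj
        exact hj hj0
  · rw [autocorrPoly_coeff, if_pos hk]
    obtain ⟨hk1, hk2⟩ := Finset.mem_Icc.1 hk
    refine div_pos ?_ hpos
    have := hdiff ((k : ℤ) - 1) (by omega) (by omega)
    rwa [show (k : ℤ) - 1 + 2 = k + 1 by ring] at this
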